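/- Let $A\in\mathbb{R}^{n\times n}$ be symmetric and not positive definite, let $a,b\in\mathbb{R}^n$ and $c,\Delta\in\mathbb{R}$ with $\Delta>0$, and consider the extended trust region subproblem $$\text{(eTRS)}\qquad p^*=\min\{x^TAx-2a^Tx:\ \|x\|^2\le\Delta,\ b^Tx\le c\}.$$ Assume the Slater condition: there is $\hat x$ with $\|\hat x\|^2<\Delta$ and $b^T\hat x<c$. Strong duality for eTRS means $p^*=d^*$, where $$d^*=\sup_{\lambda_1,\lambda_2\ge 0}\ \inf_{x\in\mathbb{R}^n}\ \big(x^TAx-2a^Tx+\lambda_1(\|x\|^2-\Delta)+\lambda_2(b^Tx-c)\big)$$ is the optimal value of the Lagrangian dual. For $t,\lambda\in\mathbb{R}$ put $$D(t,\lambda)=\begin{bmatrix}t&(-a+\tfrac{\lambda}{2}b)^T\\ -a+\tfrac{\lambda}{2}b&A\end{bmatrix},\qquad k(t,\lambda)=(\Delta+1)\lambda_{\min}(D(t,\lambda))-t-\lambda c,$$ where $\lambda_{\min}$ denotes the least eigenvalue, and let $(t^*,\lambda^*)$ be an optimal solution of the concave problem $\max\{k(t,\lambda):\ t\in\mathbb{R},\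 \lambda\ge 0\}$. (The constraint $\lambda_{\min}(D(t,\lambda))\le 0$ is redundant because $A$ is not positive definite.) 1. Suppose $\lambda_{\min}(D(t^*,\lambda^*))<\lambda_{\min}(A)$. Then strong duality holds for eTRS, and for every normalized (unit-length) eigenvector $[y_0,z^T]^T$ of $D(t^*,\lambda^*)$ for $\lambda_{\min}(D(t^*,\lambda^*))$, where $y_0\in\mathbb{R}$ and $z\in\mathbb{R}^n$, one has $y_0\ne 0$ and $x^*=z/y_0$ is a global optimal solution of eTRS. 2. Suppose $\lambda_{\min}(D(t^*,\lambda^*))=\lambda_{\min}(A)$. Then there is a normalized eigenvector $[y_0,z_0^T]^T$ of $D(t^*,\lambda^*)$ for $\lambda_{\min}(D(t^*,\lambda^*))$ with $y_0\neq 0$, and the following hold. 2.1. If $\lambda_{\min}(A)<0$ has multiplicity one, $\lambda^*>0$, and the linear system $(A-\lambda_{\min}(A)I)x=a-\frac{\lambda^*}{2}b$ has two solutions $x_1,x_2$ with $x_i^Tx_i=\Delta$ $(i=1,2)$ and $(b^Tx_1-c)(b^Tx_2-c)<0$, then strong duality fails for eTRS. 2.2. Otherwise, strong duality holds for eTRS,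 and for every normalized eigenvector $[y_0,z_0^T]^T$ of $D(t^*,\lambda^*)$ for $\lambda_{\min}(D(t^*,\lambda^*))$ with $y_0\ne 0$ there exists $z\in\mathrm{Null}(A-\lambda_{\min}(A)I)$ (an eigenvector of $A$ for $\lambda_{\min}(A)$, or $z=0$) such that $z_0/y_0+z$ is a global optimal solution of eTRS. -/

import Mathlib

open Matrix

noncomputable section

/-- The objective `xᵀAx - 2aᵀx` of the extended trust region subproblem (eTRS). -/
def etrsObj {n : ℕ} (A : Matrix (Fin n) (Fin n) ℝ) (a x : Fin n → ℝ) : ℝ :=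
  x ⬝ᵥ (A *ᵥ x) - 2 * (a ⬝ᵥ x)

/-- The feasible set `{x : ‖x‖² ≤ Δ, bᵀx ≤ c}` of eTRS (Euclidean norm, `‖x‖² = xᵀx`). -/
def etrsFeasible {n : ℕ} (b : Fin n → ℝ) (c Δ : ℝ) : Set (Fin n → ℝ) :=
  {x | x ⬝ᵥ x ≤ Δ ∧ b ⬝ᵥ x ≤ c}

/-- `x` is a global optimal solution of eTRS. -/
def IsEtrsOptimal {n : ℕ} (A : Matrix (Fin n) (Fin n) ℝ) (a b : Fin n → ℝ) (c Δ : ℝ)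
    (x : Fin n → ℝ) : Prop :=
  x ∈ etrsFeasible b c Δ ∧ ∀ w ∈ etrsFeasible b c Δ, etrsObj A a x ≤ etrsObj A a w

/-- The optimal value `p*` of eTRS. -/
def etrsValue {n : ℕ} (A : Matrix (Fin n) (Fin n) ℝ) (a b : Fin n → ℝ) (c Δ : ℝ) : EReal :=
  ⨅ x ∈ etrsFeasible b c Δ, ((etrsObj A a x : ℝ) : EReal)

/-- The Lagrangian of eTRS, with multiplier `l₁` for the norm constraint and `l₂` for the
linear constraint. -/
def etrsLagrangian {n : ℕ} (A : Matrix (Fin n) (Fin n) ℝ) (a b : Fin n → ℝ) (c Δ : ℝ)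
    (l₁ l₂ : ℝ) (x : Fin n → ℝ) : ℝ :=
  etrsObj A a x + l₁ * (x ⬝ᵥ x - Δ) + l₂ * (b ⬝ᵥ x - c)

/-- The optimal value `d*` of the Lagrangian dual of eTRS. -/
def etrsDualValue {n : ℕ} (A : Matrix (Fin n) (Fin n) ℝ) (a b : Fin n → ℝ) (c Δ : ℝ) : EReal :=
  ⨆ (l₁ : ℝ) (_ : 0 ≤ l₁) (l₂ : ℝ) (_ : 0 ≤ l₂),
    ⨅ x : Fin n → ℝ, ((etrsLagrangian A a b c Δ l₁ l₂ x : ℝ) : EReal)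

/-- Strong duality for eTRS: the optimal values of eTRS and of its Lagrangian dual agree. -/
def EtrsStrongDuality {n : ℕ} (A : Matrix (Fin n) (Fin n) ℝ) (a b : Fin n → ℝ) (c Δ : ℝ) : Prop :=
  etrsValue A a b c Δ = etrsDualValue A a b c Δ

/-- The least (real) eigenvalue of a symmetric real matrix. -/
def lambdaMin {m : Type} [Fintype m] [DecidableEq m] (M : Matrix m m ℝ) : ℝ :=
  sInf (spectrum ℝ M)

/-- The bordered matrix `D(t, l) = [t, (-a + (l/2) b)ᵀ; -a + (l/2) b, A]`. -/
def borderedD {n : ℕ} (A : Matrix (Fin n) (Fin n) ℝ) (a b : Fin n → ℝ) (t l : ℝ) :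
    Matrix (Unit ⊕ Fin n) (Unit ⊕ Fin n) ℝ :=
  Matrix.fromBlocks (Matrix.of fun _ _ => t) (Matrix.of fun _ j => -a j + l / 2 * b j)
    (Matrix.of fun i _ => -a i + l / 2 * b i) A

/-- The dual objective `k(t, l) = (Δ + 1) λ_min(D(t, l)) - t - l c`. -/
def dualK {n : ℕ} (A : Matrix (Fin n) (Fin n) ℝ) (a b : Fin n → ℝ) (c Δ t l : ℝ) : ℝ :=
  (Δ + 1) * lambdaMin (borderedD A a b t l) - t - l * c

/-- `(t, l)` is an optimal solution of the problem of maximizing `k` over `ℝ × [0, ∞)`. -/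
def IsDualKOptimal {n : ℕ} (A : Matrix (Fin n) (Fin n) ℝ) (a b : Fin n → ℝ) (c Δ t l : ℝ) : Prop :=
  0 ≤ l ∧ ∀ t' l' : ℝ, 0 ≤ l' → dualK A a b c Δ t' l' ≤ dualK A a b c Δ t l

/-- `[y₀; z]` is a normalized eigenvector of `D(t, l)` for its least eigenvalue. -/
def IsNormalizedBottomEigenvector {n : ℕ} (A : Matrix (Fin n) (Fin n) ℝ) (a b : Fin n → ℝ)
    (t l y₀ : ℝ) (z : Fin n → ℝ) : Prop :=
  borderedD A a b t l *ᵥ Sum.elim (fun _ => y₀) z =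
      lambdaMin (borderedD A a b t l) • Sum.elim (fun _ => y₀) z ∧
    y₀ ^ 2 + z ⬝ᵥ z = 1

/-- `λ_min(A) < 0` has multiplicity one, `l > 0`, and `(A - λ_min(A) I) x = a - (l/2) b` has two
solutions on the sphere `‖x‖² = Δ` strictly on opposite sides of the hyperplane `bᵀx = c`. -/
def GapCondition {n : ℕ} (A : Matrix (Fin n) (Fin n) ℝ) (a b : Fin n → ℝ) (c Δ l : ℝ) : Prop :=
  lambdaMin A < 0 ∧
  Module.finrank ℝ (Module.End.eigenspace (Matrix.toLin' A) (lambdaMin A)) = 1 ∧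
  0 < l ∧
  ∃ x₁ x₂ : Fin n → ℝ,
    (A - lambdaMin A • (1 : Matrix (Fin n) (Fin n) ℝ)) *ᵥ x₁ = a - (l / 2) • b ∧
    (A - lambdaMin A • (1 : Matrix (Fin n) (Fin n) ℝ)) *ᵥ x₂ = a - (l / 2) • b ∧
    x₁ ⬝ᵥ x₁ = Δ ∧ x₂ ⬝ᵥ x₂ = Δ ∧
    (b ⬝ᵥ x₁ - c) * (b ⬝ᵥ x₂ - c) < 0

end

/-! Homogenisation drives everything. With `s` in place of `-λ₁`, the Lagrangian at `x` is the
quadratic form of `D(t, l) - s I` at `(1, x)` plus the constant `(Δ + 1) s - t - l c`. A lower bound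
on the Lagrangian is thus a lower bound on `λ_min(D)` for a suitable `t`, and `d*` is the maximum of
`k` (`etrsDualValue_eq_dualK`). Strong duality therefore amounts to a feasible `x` such that `(1,
x)` is a bottom eigenvector of `D(t*, l*)` and complementarity holds.

Such points come from maximality of `k`: every admissible direction is matched by a unit bottom
eigenvector satisfying a first-order inequality (`exists_bottomEigenvector_direction`). If `λ_min(D)
< λ_min(A)`, the bottom eigenspace is a line, so one vector serves all directions and gives
feasibility and complementarity.

If the two eigenvalues agree, the candidates form `x + N`, with `N` the bottom eigenspace of `A`, `x
⟂ N` and `‖x‖² ≤ Δ`. Maximality makes the hyperplane meet the ball in `x + N` when `l > 0`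
(`mul_sub_le_of_isDualKOptimal`). A complementary point can be missing only if it must lie on both
sphere and hyperplane while `N` is a line: the sphere then leaves at most two points, and the gap
condition puts them strictly on opposite sides. -/

section Spectral

/-! ### Rayleigh bounds for the least eigenvalue. -/

variable {m : Type} [Fintype m] [DecidableEq m] {M : Matrix m m ℝ}

theorem exists_unit_eigenvector_lambdaMin [Nonempty m] (hM : M.IsSymm) :
    ∃ v : m → ℝ, v ⬝ᵥ v = 1 ∧ M *ᵥ v = lambdaMin M • v := by
  have hH : M.IsHermitian := by
    rw [IsHermitian, conjTranspose_eq_transpose_of_trivial, hM.eq]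
  have hne : (Set.range hH.eigenvalues).Nonempty := Set.range_nonempty _
  have hmem := hne.csInf_mem (Set.finite_range _)
  rw [← hH.spectrum_real_eq_range_eigenvalues] at hmem
  have hmem' := hmem
  rw [hH.spectrum_real_eq_range_eigenvalues] at hmem'
  obtain ⟨i, hi⟩ := hmem'
  refine ⟨⇑(hH.eigenvectorBasis i), ?_, ?_⟩
  · have h1 := hH.eigenvectorBasis.orthonormal.1 i
    have h2 := real_inner_self_eq_norm_sq (hH.eigenvectorBasis i)
    rw [h1] at h2
    rw [PiLp.inner_apply] at h2
    simpa only [dotProduct, RCLike.inner_apply, conj_trivial, one_pow] using h2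
  · rw [hH.mulVec_eigenvectorBasis i, hi]
    rw [lambdaMin, hH.spectrum_real_eq_range_eigenvalues]

theorem posSemidef_sub_lambdaMin (hM : M.IsSymm) :
    (M - lambdaMin M • (1 : Matrix m m ℝ)).PosSemidef := by
  have hH : M.IsHermitian := by
    rw [IsHermitian, conjTranspose_eq_transpose_of_trivial, hM.eq]
  refine posSemidef_iff_isHermitian_and_spectrum_nonneg.2 ⟨?_, ?_⟩
  · simp [IsHermitian, conjTranspose_eq_transpose_of_trivial, hM.eq]
  · rw [← Algebra.algebraMap_eq_smul_one, ← spectrum.sub_singleton_eq]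
    rintro _ ⟨x, hx, _, rfl, rfl⟩
    have hb : BddBelow (spectrum ℝ M) := by
      rw [hH.spectrum_real_eq_range_eigenvalues]
      exact (Set.finite_range _).bddBelow
    have := csInf_le hb hx
    exact sub_nonneg.2 this

theorem dotProduct_sub_smul_one_mulVec (r : ℝ) (v : m → ℝ) :
    v ⬝ᵥ ((M - r • (1 : Matrix m m ℝ)) *ᵥ v) = v ⬝ᵥ (M *ᵥ v) - r * (v ⬝ᵥ v) := by
  simp [sub_mulVec, dotProduct_sub, smul_mulVec]

theorem lambdaMin_mul_le (hM : M.IsSymm) (v : m → ℝ) :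
    lambdaMin M * (v ⬝ᵥ v) ≤ v ⬝ᵥ (M *ᵥ v) := by
  have h := (posSemidef_sub_lambdaMin hM).dotProduct_mulVec_nonneg v
  rw [star_trivial, dotProduct_sub_smul_one_mulVec] at h
  linarith

theorem mulVec_eq_lambdaMin_smul_of_le (hM : M.IsSymm) {v : m → ℝ}
    (h : v ⬝ᵥ (M *ᵥ v) ≤ lambdaMin M * (v ⬝ᵥ v)) : M *ᵥ v = lambdaMin M • v := by
  have h0 := (posSemidef_sub_lambdaMin hM).dotProduct_mulVec_zero_iff v
  rw [star_trivial, dotProduct_sub_smul_one_mulVec] at h0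
  have := h0.1 (by linarith [lambdaMin_mul_le hM v])
  simpa [sub_mulVec, smul_mulVec, sub_eq_zero] using this

theorem le_lambdaMin [Nonempty m] (hM : M.IsSymm) {r : ℝ}
    (h : ∀ v : m → ℝ, r * (v ⬝ᵥ v) ≤ v ⬝ᵥ (M *ᵥ v)) : r ≤ lambdaMin M := by
  obtain ⟨v, hv, hMv⟩ := exists_unit_eigenvector_lambdaMin hM
  simpa [hMv, hv] using h v

theorem lambdaMin_nonpos_of_not_posDef (hM : M.IsSymm) (h : ¬ M.PosDef) : lambdaMin M ≤ 0 := by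
  by_contra! hpos
  refine h (PosDef.of_dotProduct_mulVec_pos ?_ fun v hv => ?_)
  · rw [IsHermitian, conjTranspose_eq_transpose_of_trivial, hM.eq]
  · have := lambdaMin_mul_le hM v
    have h1 : 0 < v ⬝ᵥ v := by simpa using dotProduct_star_self_pos_iff.2 hv
    rw [star_trivial]
    nlinarith

end Spectral

/-- The empty matrix is vacuously positive definite. -/
theorem nonempty_of_not_posDef {n : ℕ} {A : Matrix (Fin n) (Fin n) ℝ} (h : ¬ A.PosDef) :
    Nonempty (Fin n) := by
  by_contra hn
  rw [not_nonempty_iff] at hn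
  exact h ⟨Subsingleton.elim _ _, fun x hx => absurd (Subsingleton.elim x 0) hx⟩

theorem dotProduct_self_nonneg_real {n : ℕ} (x : Fin n → ℝ) : 0 ≤ x ⬝ᵥ x := by
  simpa using dotProduct_star_self_nonneg x

/-! ### The bordered matrix and the Lagrangian dual. -/

section Bordered

variable {n : ℕ} {A : Matrix (Fin n) (Fin n) ℝ} {a b : Fin n → ℝ} {c Δ t l : ℝ}

theorem borderedD_isSymm (hA : A.IsSymm) : (borderedD A a b t l).IsSymm := by
  refine IsSymm.fromBlocks ?_ ?_ hA
  · ext; rfl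
  · ext; rfl

theorem sumElim_dotProduct_self (y : ℝ) (z : Fin n → ℝ) :
    Sum.elim (fun _ : Unit => y) z ⬝ᵥ Sum.elim (fun _ : Unit => y) z = y ^ 2 + z ⬝ᵥ z := by
  simp [dotProduct, pow_two]

theorem borderedD_mulVec (y : ℝ) (z : Fin n → ℝ) :
    borderedD A a b t l *ᵥ Sum.elim (fun _ => y) z =
      Sum.elim (fun _ => t * y - (a - (l / 2) • b) ⬝ᵥ z)
        (A *ᵥ z - y • (a - (l / 2) • b)) := by
  rw [borderedD, fromBlocks_mulVec]
  ext i
  rcases i with i | i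
  · simp only [Sum.elim_inl, mulVec, dotProduct, Pi.add_apply, of_apply, Function.comp_apply,
      Sum.elim_inr, Pi.sub_apply, Pi.smul_apply, smul_eq_mul, Finset.univ_unique,
      Finset.sum_singleton]
    rw [sub_eq_add_neg, ← Finset.sum_neg_distrib]
    congr 1
    exact Finset.sum_congr rfl fun j _ => by ring
  · simp only [Sum.elim_inr, mulVec, dotProduct, Pi.add_apply, of_apply, Function.comp_apply,
      Sum.elim_inl, Pi.sub_apply, Pi.smul_apply, smul_eq_mul, Finset.univ_unique,
      Finset.sum_singleton]
    ring

theorem borderedD_mulVec_eq_smul_iff (s y : ℝ) (z : Fin n → ℝ) :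
    borderedD A a b t l *ᵥ Sum.elim (fun _ => y) z = s • Sum.elim (fun _ => y) z ↔
      t * y - (a - (l / 2) • b) ⬝ᵥ z = s * y ∧ A *ᵥ z - y • (a - (l / 2) • b) = s • z := by
  rw [borderedD_mulVec]
  constructor
  · intro h
    exact ⟨congrFun h (Sum.inl ()), funext fun i => congrFun h (Sum.inr i)⟩
  · rintro ⟨h1, h2⟩
    ext i
    rcases i with i | i
    · exact h1
    · exact congrFun h2 i

theorem borderedD_quadratic (y : ℝ) (z : Fin n → ℝ) :
    Sum.elim (fun _ => y) z ⬝ᵥ (borderedD A a b t l *ᵥ Sum.elim (fun _ => y) z) =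
      t * y ^ 2 + y * (-(2 * (a ⬝ᵥ z)) + l * (b ⬝ᵥ z)) + z ⬝ᵥ (A *ᵥ z) := by
  rw [borderedD_mulVec]
  have : Sum.elim (fun _ : Unit => y) z ⬝ᵥ Sum.elim (fun _ : Unit => t * y - (a - (l / 2) • b) ⬝ᵥ z)
        (A *ᵥ z - y • (a - (l / 2) • b)) = y * (t * y - (a - (l / 2) • b) ⬝ᵥ z) +
        z ⬝ᵥ (A *ᵥ z - y • (a - (l / 2) • b)) := by simp [dotProduct]
  rw [this]
  simp only [dotProduct_sub, sub_dotProduct, smul_dotProduct, dotProduct_smul, smul_eq_mul,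
    dotProduct_comm z a, dotProduct_comm z b]
  ring

theorem sumElim_eta (v : Unit ⊕ Fin n → ℝ) :
    Sum.elim (fun _ : Unit => v (Sum.inl ())) (fun i => v (Sum.inr i)) = v := by
  ext i; rcases i with i | i <;> rfl

theorem lambdaMin_borderedD_mul_le (hA : A.IsSymm) (y : ℝ) (z : Fin n → ℝ) :
    lambdaMin (borderedD A a b t l) * (y ^ 2 + z ⬝ᵥ z) ≤
      t * y ^ 2 + y * (-(2 * (a ⬝ᵥ z)) + l * (b ⬝ᵥ z)) + z ⬝ᵥ (A *ᵥ z) := by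
  have h := lambdaMin_mul_le (borderedD_isSymm (a := a) (b := b) (t := t) (l := l) hA)
    (Sum.elim (fun _ => y) z)
  rwa [sumElim_dotProduct_self, borderedD_quadratic] at h

theorem le_lambdaMin_borderedD (hA : A.IsSymm) {r : ℝ}
    (h : ∀ (y : ℝ) (z : Fin n → ℝ), r * (y ^ 2 + z ⬝ᵥ z) ≤
      t * y ^ 2 + y * (-(2 * (a ⬝ᵥ z)) + l * (b ⬝ᵥ z)) + z ⬝ᵥ (A *ᵥ z)) :
    r ≤ lambdaMin (borderedD A a b t l) := by
  refine le_lambdaMin (borderedD_isSymm hA) fun v => ?_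
  rw [← sumElim_eta v, sumElim_dotProduct_self, borderedD_quadratic]
  exact h _ _

theorem lambdaMin_borderedD_le (hA : A.IsSymm) [Nonempty (Fin n)] :
    lambdaMin (borderedD A a b t l) ≤ lambdaMin A := by
  refine le_lambdaMin hA fun z => ?_
  simpa using lambdaMin_borderedD_mul_le (a := a) (b := b) (t := t) (l := l) hA 0 z

theorem etrsLagrangian_eq (s : ℝ) (x : Fin n → ℝ) :
    etrsLagrangian A a b c Δ (-s) l x =
      (t * 1 ^ 2 + 1 * (-(2 * (a ⬝ᵥ x)) + l * (b ⬝ᵥ x)) + x ⬝ᵥ (A *ᵥ x) - s * (1 ^ 2 + x ⬝ᵥ x))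
        + ((Δ + 1) * s - t - l * c) := by
  simp only [etrsLagrangian, etrsObj]
  ring

theorem dualK_le_etrsLagrangian (hA : A.IsSymm) (x : Fin n → ℝ) :
    dualK A a b c Δ t l ≤
      etrsLagrangian A a b c Δ (-lambdaMin (borderedD A a b t l)) l x := by
  rw [etrsLagrangian_eq (t := t), dualK]
  linarith [lambdaMin_borderedD_mul_le (a := a) (b := b) (t := t) (l := l) hA 1 x]

theorem nonneg_of_forall_le_quadratic {q d v : ℝ} (h : ∀ s : ℝ, v ≤ q * s ^ 2 + d * s) : 0 ≤ q := by
  by_contra! hq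
  have hq' : q ≠ 0 := hq.ne
  have h1 := h ((|v| + |d| + 1) / -q)
  have h2 := h (-((|v| + |d| + 1) / -q))
  -- Averaging the bounds at `±(w + 1)` cancels the linear term, and `q * (w + 1) ^ 2` falls below
  -- `-|v|`.
  set w := (|v| + |d| + 1) / -q with hw
  have hqw : q * w = -(|v| + |d| + 1) := by rw [hw]; field_simp
  have hadd : v ≤ q * w * w := by nlinarith
  rw [hqw] at hadd
  have h3 : v ≤ q * (w + 1) ^ 2 + d * (w + 1) := h _
  have h4 : v ≤ q * (-(w + 1)) ^ 2 + d * (-(w + 1)) := h _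
  have hw0 : 0 ≤ w := by rw [hw]; apply div_nonneg <;> [positivity; linarith]
  have h5 : v ≤ q * (w + 1) ^ 2 := by nlinarith
  have h6 : q * (w + 1) ^ 2 = q * w * w + 2 * (q * w) + q := by ring
  rw [h6, hqw] at h5
  have := neg_abs_le v
  have := abs_nonneg d
  have := abs_nonneg v
  nlinarith

theorem exists_le_dualK (hA : A.IsSymm) {l₁ l₂ v : ℝ} (hΔ : 0 < Δ)
    (h : ∀ x, v ≤ etrsLagrangian A a b c Δ l₁ l₂ x) : ∃ t', v ≤ dualK A a b c Δ t' l₂ := by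
  -- With this `t'`, the form of `D(t', l₂) + l₁ I` is the homogenisation of the Lagrangian minus
  -- `v`. The slice `y = 0` is its leading part, nonnegative because the Lagrangian is bounded below
  -- on lines.
  refine ⟨-l₁ - (v + l₁ * Δ + l₂ * c), ?_⟩
  have key : -l₁ ≤ lambdaMin (borderedD A a b (-l₁ - (v + l₁ * Δ + l₂ * c)) l₂) := by
    refine le_lambdaMin_borderedD hA fun y z => ?_
    rcases eq_or_ne y 0 with rfl | hy
    · have h0 : 0 ≤ z ⬝ᵥ (A *ᵥ z) + l₁ * (z ⬝ᵥ z) := by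
        refine nonneg_of_forall_le_quadratic (d := -(2 * (a ⬝ᵥ z)) + l₂ * (b ⬝ᵥ z))
          (v := v + l₁ * Δ + l₂ * c) fun s => ?_
        have := h (s • z)
        simp only [etrsLagrangian, etrsObj, mulVec_smul, dotProduct_smul, smul_dotProduct,
          smul_eq_mul] at this
        linarith
      linarith
    · have := h (y⁻¹ • z)
      simp only [etrsLagrangian, etrsObj, mulVec_smul, dotProduct_smul, smul_dotProduct,
          smul_eq_mul] at this
      have h2 := mul_le_mul_of_nonneg_left this (sq_nonneg y)
      have e : y ^ 2 * (y⁻¹ * (y⁻¹ * z ⬝ᵥ A *ᵥ z) - 2 * (y⁻¹ * a ⬝ᵥ z) +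
          l₁ * (y⁻¹ * (y⁻¹ * z ⬝ᵥ z) - Δ) + l₂ * (y⁻¹ * b ⬝ᵥ z - c)) =
          z ⬝ᵥ A *ᵥ z - 2 * y * a ⬝ᵥ z + l₁ * (z ⬝ᵥ z - y ^ 2 * Δ) +
          l₂ * (y * b ⬝ᵥ z - y ^ 2 * c) := by
        generalize z ⬝ᵥ A *ᵥ z = p₁
        generalize a ⬝ᵥ z = p₂
        generalize z ⬝ᵥ z = p₃
        generalize b ⬝ᵥ z = p₄
        field_simp
      rw [e] at h2
      linarith
  rw [dualK]
  nlinarith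

theorem etrsDualValue_eq_dualK (hA : A.IsSymm) (hA' : ¬ A.PosDef) (hΔ : 0 < Δ)
    (hopt : IsDualKOptimal A a b c Δ t l) :
    etrsDualValue A a b c Δ = ((dualK A a b c Δ t l : ℝ) : EReal) := by
  have := nonempty_of_not_posDef hA'
  apply le_antisymm
  · refine iSup₂_le fun l₁ hl₁ => iSup₂_le fun l₂ hl₂ => ?_
    by_contra! hlt
    -- The infimum is an extended real, so a real `q` strictly in between serves as the lower bound.
    obtain ⟨q, hq1, hq2⟩ := EReal.lt_iff_exists_real_btwn.1 hlt
    obtain ⟨t', ht'⟩ := exists_le_dualK (A := A) (a := a) (b := b) (c := c) (l₁ := l₁)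
      (l₂ := l₂) (v := q) hA hΔ fun x => by
        have := hq2.le.trans (iInf_le _ x)
        exact_mod_cast this
    have := hopt.2 t' l₂ hl₂
    have hq1' : dualK A a b c Δ t l < q := by exact_mod_cast hq1
    linarith
  · have hs : 0 ≤ -lambdaMin (borderedD A a b t l) := by
      linarith [lambdaMin_borderedD_le (a := a) (b := b) (t := t) (l := l) hA,
        lambdaMin_nonpos_of_not_posDef hA hA']
    refine le_trans ?_ (le_iSup₂_of_le _ hs (le_iSup₂_of_le l hopt.1 le_rfl))
    refine le_iInf fun x => ?_
    exact_mod_cast dualK_le_etrsLagrangian hA x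

theorem etrsLagrangian_le_etrsObj {l₁ l₂ : ℝ} (h₁ : 0 ≤ l₁) (h₂ : 0 ≤ l₂) {x : Fin n → ℝ}
    (hx : x ∈ etrsFeasible b c Δ) : etrsLagrangian A a b c Δ l₁ l₂ x ≤ etrsObj A a x := by
  have h3 := mul_nonneg h₁ (sub_nonneg.2 hx.1)
  have h4 := mul_nonneg h₂ (sub_nonneg.2 hx.2)
  simp only [etrsLagrangian]
  linarith

/-- A complementary feasible solution of the stationarity system certifies strong duality. -/
theorem strongDuality_and_isEtrsOptimal (hA : A.IsSymm) (hA' : ¬ A.PosDef) (hΔ : 0 < Δ)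
    (hopt : IsDualKOptimal A a b c Δ t l) {x : Fin n → ℝ}
    (hx : borderedD A a b t l *ᵥ Sum.elim (fun _ => 1) x =
      lambdaMin (borderedD A a b t l) • Sum.elim (fun _ => 1) x)
    (hf : x ∈ etrsFeasible b c Δ)
    (hc₁ : lambdaMin (borderedD A a b t l) * (x ⬝ᵥ x - Δ) = 0)
    (hc₂ : l * (b ⬝ᵥ x - c) = 0) :
    EtrsStrongDuality A a b c Δ ∧ IsEtrsOptimal A a b c Δ x := by
  have := nonempty_of_not_posDef hA'
  have hs : 0 ≤ -lambdaMin (borderedD A a b t l) := by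
    linarith [lambdaMin_borderedD_le (a := a) (b := b) (t := t) (l := l) hA,
      lambdaMin_nonpos_of_not_posDef hA hA']
  have hobj : etrsObj A a x = dualK A a b c Δ t l := by
    have h1 := borderedD_quadratic (A := A) (a := a) (b := b) (t := t) (l := l) 1 x
    rw [hx, dotProduct_smul, sumElim_dotProduct_self, smul_eq_mul] at h1
    have h2 := etrsLagrangian_eq (A := A) (a := a) (b := b) (t := t) (l := l) (c := c) (Δ := Δ)
      (lambdaMin (borderedD A a b t l)) x
    rw [← h1, etrsLagrangian] at h2
    rw [dualK]
    linarith
  have hmin : ∀ w ∈ etrsFeasible b c Δ, etrsObj A a x ≤ etrsObj A a w := fun w hw => by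
    rw [hobj]
    exact (dualK_le_etrsLagrangian hA w).trans (etrsLagrangian_le_etrsObj hs hopt.1 hw)
  refine ⟨?_, hf, hmin⟩
  rw [EtrsStrongDuality, etrsDualValue_eq_dualK hA hA' hΔ hopt, ← hobj, etrsValue]
  apply le_antisymm
  · exact iInf₂_le x hf
  · exact le_iInf₂ fun w hw => by exact_mod_cast hmin w hw

/-! ### First-order optimality of the dual pair. -/

theorem isCompact_dotProduct_self_eq_one (m : Type) [Fintype m] :
    IsCompact {v : m → ℝ | v ⬝ᵥ v = 1} := by
  refine Metric.isCompact_of_isClosed_isBounded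
    (isClosed_eq (by simp only [dotProduct]; fun_prop) continuous_const) ?_
  refine (Metric.isBounded_closedBall (x := (0 : m → ℝ)) (r := 1)).subset fun v hv => ?_
  rw [mem_closedBall_zero_iff, pi_norm_le_iff_of_nonneg zero_le_one]
  intro i
  have h : v i * v i ≤ v ⬝ᵥ v :=
    Finset.single_le_sum (f := fun j => v j * v j) (fun j _ => mul_self_nonneg _) (Finset.mem_univ i)
  rw [show v ⬝ᵥ v = 1 from hv] at h
  rw [Real.norm_eq_abs, ← sq_le_one_iff_abs_le_one]
  linarith [pow_two (v i)]

/-- First-order optimality of the dual pair `(t, l)` in an admissible direction `(s, r)`. -/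
theorem exists_bottomEigenvector_direction (hA : A.IsSymm) (hΔ : 0 < Δ)
    (hopt : IsDualKOptimal A a b c Δ t l) (s r : ℝ) (hr : 0 < l ∨ 0 ≤ r) :
    ∃ (y : ℝ) (z : Fin n → ℝ), IsNormalizedBottomEigenvector A a b t l y z ∧
      (Δ + 1) * (s * y ^ 2 + r * (y * (b ⬝ᵥ z))) ≤ s + r * c := by
  obtain ⟨δ, hδ, hδr⟩ : ∃ δ : ℝ, 0 < δ ∧ ∀ ε, 0 ≤ ε → ε ≤ δ → 0 ≤ l + ε * r := by
    rcases le_or_gt 0 r with h | h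
    · exact ⟨1, one_pos, fun ε h0 _ => add_nonneg hopt.1 (mul_nonneg h0 h)⟩
    · have hl : 0 < l := hr.resolve_right h.not_ge
      refine ⟨l / -r, div_pos hl (by linarith), fun ε _ h1 => ?_⟩
      rw [le_div_iff₀ (by linarith)] at h1
      linarith
  -- `w` is the derivative of the quadratic form of `D` in the direction `(s, r)`.
  set w : (Unit ⊕ Fin n → ℝ) → ℝ := fun v =>
    s * v (Sum.inl ()) ^ 2 + r * (v (Sum.inl ()) * (b ⬝ᵥ fun i => v (Sum.inr i))) with hw
  set Q : (Unit ⊕ Fin n → ℝ) → ℝ := fun v => v ⬝ᵥ (borderedD A a b t l *ᵥ v) with hQ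
  have hwc : Continuous w := by simp only [hw, dotProduct]; fun_prop
  have hQc : Continuous Q := by simp only [hQ, dotProduct, mulVec]; fun_prop
  set K : Set (Unit ⊕ Fin n → ℝ) := {v | v ⬝ᵥ v = 1} ∩ {v | (Δ + 1) * w v ≤ s + r * c} with hK
  have hKc : IsCompact K := (isCompact_dotProduct_self_eq_one _).inter_right
    (isClosed_le (by fun_prop) continuous_const)
  -- A bottom eigenvector of the perturbed matrix lies in `K` because `k` does not increase, and its
  -- form `Q` is within `O(ε)` of the minimum.
  have hpert : ∀ ε, 0 < ε → ε ≤ δ → ∃ v ∈ K, (Δ + 1) * Q v ≤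
      (Δ + 1) * lambdaMin (borderedD A a b t l) + ε * (s + r * c - (Δ + 1) * w v) := by
    intro ε h0 h1
    obtain ⟨v, hv1, hv⟩ := exists_unit_eigenvector_lambdaMin
      (borderedD_isSymm (a := a) (b := b) (t := t + ε * s) (l := l + ε * r) hA)
    have hle := hopt.2 (t + ε * s) (l + ε * r) (hδr ε h0.le h1)
    have hq : lambdaMin (borderedD A a b (t + ε * s) (l + ε * r)) = Q v + ε * w v := by
      have e1 : v ⬝ᵥ (borderedD A a b (t + ε * s) (l + ε * r) *ᵥ v) = Q v + ε * w v := by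
        simp only [hQ, hw]
        conv_lhs => rw [← sumElim_eta v, borderedD_quadratic]
        conv_rhs => enter [1]; rw [← sumElim_eta v, borderedD_quadratic]
        ring
      rw [← e1, hv, dotProduct_smul, hv1, smul_eq_mul, mul_one]
    have hlow : lambdaMin (borderedD A a b t l) ≤ Q v := by
      simpa [hv1] using lambdaMin_mul_le (borderedD_isSymm (a := a) (b := b) (t := t) (l := l) hA) v
    rw [dualK, dualK, hq] at hle
    have hlow' := mul_le_mul_of_nonneg_left hlow (by linarith : (0 : ℝ) ≤ Δ + 1)
    refine ⟨v, ⟨hv1, ?_⟩, by linarith⟩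
    have : ε * ((Δ + 1) * w v) ≤ ε * (s + r * c) := by linarith
    exact le_of_mul_le_mul_left this h0
  obtain ⟨v₀, hv₀, -⟩ := hpert δ hδ le_rfl
  obtain ⟨v, hvK, hvmin⟩ := hKc.exists_isMinOn ⟨v₀, hv₀⟩ hQc.continuousOn
  obtain ⟨C, hC⟩ := hKc.bddAbove_image
    (f := fun v => s + r * c - (Δ + 1) * w v) (by fun_prop)
  have hQv : Q v ≤ lambdaMin (borderedD A a b t l) := by
    by_contra! hlt
    set η := (Δ + 1) * (Q v - lambdaMin (borderedD A a b t l)) with hη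
    have hη0 : 0 < η := mul_pos (by linarith) (by linarith)
    have hC1 : 0 < |C| + 1 := by positivity
    -- For this `ε` the excess allowed by `hpert` is at most `ε * |C| < η`.
    set ε := min δ (η / (|C| + 1)) with hε
    have hε0 : 0 < ε := lt_min hδ (div_pos hη0 hC1)
    obtain ⟨v', hv', h'⟩ := hpert ε hε0 (min_le_left _ _)
    have h1 : Q v ≤ Q v' := hvmin hv'
    have h2 : s + r * c - (Δ + 1) * w v' ≤ C := hC ⟨v', hv', rfl⟩
    have h3 : ε * (|C| + 1) ≤ η := (le_div_iff₀ hC1).1 (min_le_right _ _)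
    have h4 : ε * (s + r * c - (Δ + 1) * w v') ≤ ε * |C| :=
      mul_le_mul_of_nonneg_left (h2.trans (le_abs_self C)) hε0.le
    have h5 : (Δ + 1) * Q v ≤ (Δ + 1) * Q v' := mul_le_mul_of_nonneg_left h1 (by linarith)
    rw [hη] at h3
    linarith
  refine ⟨v (Sum.inl ()), fun i => v (Sum.inr i), ⟨?_, ?_⟩, hvK.2⟩
  · rw [sumElim_eta]
    refine mulVec_eq_lambdaMin_smul_of_le (borderedD_isSymm hA) ?_
    rw [show v ⬝ᵥ v = 1 from hvK.1, mul_one]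
    exact hQv
  · rw [← sumElim_dotProduct_self, sumElim_eta]
    exact hvK.1

/-! ### Structure of bottom eigenvectors and the strict case. -/

theorem bottomEigenvector_normalize {s y : ℝ} {z : Fin n → ℝ} (hy : y ≠ 0)
    (h : borderedD A a b t l *ᵥ Sum.elim (fun _ => y) z = s • Sum.elim (fun _ => y) z) :
    borderedD A a b t l *ᵥ Sum.elim (fun _ => 1) (y⁻¹ • z) =
      s • Sum.elim (fun _ => 1) (y⁻¹ • z) := by
  have e : Sum.elim (fun _ : Unit => (1 : ℝ)) (y⁻¹ • z) =
      y⁻¹ • Sum.elim (fun _ : Unit => y) z := by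
    ext i
    rcases i with i | i
    · simp [hy]
    · simp
  rw [e, mulVec_smul, h, smul_comm]

theorem eigenvector_sub_of_bottomEigenvector {s y : ℝ} {x z : Fin n → ℝ}
    (hx : borderedD A a b t l *ᵥ Sum.elim (fun _ => 1) x = s • Sum.elim (fun _ => 1) x)
    (h : borderedD A a b t l *ᵥ Sum.elim (fun _ => y) z = s • Sum.elim (fun _ => y) z) :
    A *ᵥ (z - y • x) = s • (z - y • x) := by
  have h1 := ((borderedD_mulVec_eq_smul_iff _ _ _).1 hx).2
  have h2 := ((borderedD_mulVec_eq_smul_iff _ _ _).1 h).2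
  rw [one_smul, sub_eq_iff_eq_add] at h1
  rw [sub_eq_iff_eq_add] at h2
  rw [mulVec_sub, mulVec_smul, h1, h2]
  module

/-- The vector `(0, u)` has Rayleigh quotient `λ_min(A) = λ_min(D)`, so it is itself a bottom
eigenvector of `D`. -/
theorem bottomEigenvector_add (hA : A.IsSymm)
    (heq : lambdaMin (borderedD A a b t l) = lambdaMin A) {x u : Fin n → ℝ}
    (hx : borderedD A a b t l *ᵥ Sum.elim (fun _ => 1) x =
      lambdaMin (borderedD A a b t l) • Sum.elim (fun _ => 1) x)
    (hu : A *ᵥ u = lambdaMin A • u) :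
    borderedD A a b t l *ᵥ Sum.elim (fun _ => 1) (x + u) =
      lambdaMin (borderedD A a b t l) • Sum.elim (fun _ => 1) (x + u) := by
  have h0 : borderedD A a b t l *ᵥ Sum.elim (fun _ => 0) u =
      lambdaMin (borderedD A a b t l) • Sum.elim (fun _ => 0) u := by
    refine mulVec_eq_lambdaMin_smul_of_le (borderedD_isSymm hA) ?_
    rw [borderedD_quadratic, sumElim_dotProduct_self, hu, heq]
    simp
  have e : Sum.elim (fun _ : Unit => (1 : ℝ)) (x + u) =
      Sum.elim (fun _ : Unit => (1 : ℝ)) x + Sum.elim (fun _ : Unit => (0 : ℝ)) u := by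
    ext i
    rcases i with i | i <;> simp
  rw [e, mulVec_add, hx, h0, smul_add]

/-- If `λ_min(D) < λ_min(A)`, any bottom eigenvector of `D` yields an optimal solution. -/
theorem strongDuality_of_lambdaMin_lt (hA : A.IsSymm) (hA' : ¬ A.PosDef) (hΔ : 0 < Δ)
    (hopt : IsDualKOptimal A a b c Δ t l)
    (hlt : lambdaMin (borderedD A a b t l) < lambdaMin A) {y₀ : ℝ} {z : Fin n → ℝ}
    (hv : IsNormalizedBottomEigenvector A a b t l y₀ z) :
    y₀ ≠ 0 ∧ EtrsStrongDuality A a b c Δ ∧ IsEtrsOptimal A a b c Δ (y₀⁻¹ • z) := by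
  have hnull : ∀ u : Fin n → ℝ, A *ᵥ u = lambdaMin (borderedD A a b t l) • u → u = 0 := by
    intro u hu
    have h := lambdaMin_mul_le hA u
    rw [hu, dotProduct_smul, smul_eq_mul] at h
    have h0 := dotProduct_self_nonneg_real u
    exact dotProduct_self_eq_zero.1 (by nlinarith)
  have hy : y₀ ≠ 0 := by
    rintro rfl
    have hz := ((borderedD_mulVec_eq_smul_iff _ _ _).1 hv.1).2
    rw [zero_smul, sub_zero] at hz
    have h := hv.2
    rw [hnull z hz] at h
    simp at h
  have hx := bottomEigenvector_normalize hy hv.1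
  set x := y₀⁻¹ • z with hxdef
  -- The eigenvector found for each direction is a multiple of `(1, x)`, so its inequality rescales
  -- to one about `x`.
  have hall : ∀ s r : ℝ, (0 < l ∨ 0 ≤ r) →
      (Δ + 1) * (s + r * (b ⬝ᵥ x)) ≤ (s + r * c) * (1 + x ⬝ᵥ x) := by
    intro s r hr
    obtain ⟨y, w, hw, hle⟩ := exists_bottomEigenvector_direction hA hΔ hopt s r hr
    have hwx := hnull _ (eigenvector_sub_of_bottomEigenvector hx hw.1)
    rw [sub_eq_zero] at hwx
    have h1 := hw.2
    rw [hwx] at h1 hle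
    simp only [dotProduct_smul, smul_dotProduct, smul_eq_mul] at h1 hle
    have h2 : y ^ 2 * (1 + x ⬝ᵥ x) = 1 := by linarith
    have h3 : 0 < 1 + x ⬝ᵥ x := by linarith [dotProduct_self_nonneg_real x]
    have h4 := mul_le_mul_of_nonneg_right hle h3.le
    have h5 : (Δ + 1) * (s * y ^ 2 + r * (y * (y * b ⬝ᵥ x))) * (1 + x ⬝ᵥ x) =
      (Δ + 1) * (s + r * (b ⬝ᵥ x)) * (y ^ 2 * (1 + x ⬝ᵥ x)) := by ring
    rwa [h5, h2, mul_one] at h4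
  have hn : x ⬝ᵥ x = Δ := by
    have h1 := hall 1 0 (Or.inr le_rfl)
    have h2 := hall (-1) 0 (Or.inr le_rfl)
    linarith
  have hΔ1 : 0 < Δ + 1 := by linarith
  have hb : b ⬝ᵥ x ≤ c := by
    have h1 := hall 0 1 (Or.inr zero_le_one)
    rw [hn] at h1
    nlinarith
  refine ⟨hy, strongDuality_and_isEtrsOptimal hA hA' hΔ hopt hx ⟨hn.le, hb⟩ (by simp [hn]) ?_⟩
  rcases hopt.1.eq_or_lt with h | h
  · simp [← h]
  · have h1 := hall 0 (-1) (Or.inl h)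
    rw [hn] at h1
    have : b ⬝ᵥ x = c := le_antisymm hb (by nlinarith)
    simp [this]

/-! ### The case of equal least eigenvalues. -/

theorem exists_dotProduct_eq_on_submodule (K : Submodule ℝ (Fin n → ℝ)) (w : Fin n → ℝ) :
    ∃ p ∈ K, ∀ u ∈ K, w ⬝ᵥ u = p ⬝ᵥ u := by
  let e := WithLp.linearEquiv 2 ℝ (Fin n → ℝ)
  let K' : Submodule ℝ (EuclideanSpace ℝ (Fin n)) := K.comap e.toLinearMap
  have hp : e (K'.starProjection (WithLp.toLp 2 w)) ∈ K := K'.starProjection_apply_mem _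
  refine ⟨_, hp, fun u hu => ?_⟩
  have h := K'.sub_starProjection_mem_orthogonal (WithLp.toLp 2 w) (WithLp.toLp 2 u)
    (show e (WithLp.toLp 2 u) ∈ K from hu)
  rw [inner_sub_right, sub_eq_zero, EuclideanSpace.inner_eq_star_dotProduct,
    EuclideanSpace.inner_eq_star_dotProduct] at h
  simp only [star_trivial] at h
  exact h

theorem mem_eigenspace_toLin'_iff (s : ℝ) (u : Fin n → ℝ) :
    u ∈ Module.End.eigenspace (Matrix.toLin' A) s ↔ A *ᵥ u = s • u := by
  rw [Module.End.mem_eigenspace_iff, toLin'_apply]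

theorem dotProduct_sq_le_of_unit {e : Fin n → ℝ} (he : e ⬝ᵥ e = 1) (u : Fin n → ℝ) :
    (e ⬝ᵥ u) ^ 2 ≤ u ⬝ᵥ u := by
  have h := dotProduct_self_nonneg_real (u - (e ⬝ᵥ u) • e)
  simp only [sub_dotProduct, dotProduct_sub, smul_dotProduct, dotProduct_smul, smul_eq_mul, he,
    dotProduct_comm u e] at h
  linarith

/-- `B • e` is the projection of `w` onto the bottom eigenspace; if it vanishes, any unit
eigenvector serves with `B = 0`. -/
theorem exists_unit_direction_on_eigenspace [Nonempty (Fin n)] (hA : A.IsSymm) (w : Fin n → ℝ) :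
    ∃ (e : Fin n → ℝ) (B : ℝ), A *ᵥ e = lambdaMin A • e ∧ e ⬝ᵥ e = 1 ∧ 0 ≤ B ∧
      ∀ u, A *ᵥ u = lambdaMin A • u → w ⬝ᵥ u = B * (e ⬝ᵥ u) := by
  obtain ⟨p, hp, hpu⟩ := exists_dotProduct_eq_on_submodule
    (Module.End.eigenspace (Matrix.toLin' A) (lambdaMin A)) w
  simp only [mem_eigenspace_toLin'_iff] at hp hpu
  rcases eq_or_ne p 0 with rfl | hp0
  · obtain ⟨e, he1, he⟩ := exists_unit_eigenvector_lambdaMin hA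
    exact ⟨e, 0, he, he1, le_rfl, fun u hu => by rw [hpu u hu]; simp⟩
  · have hpos : 0 < p ⬝ᵥ p :=
      (dotProduct_self_nonneg_real p).lt_of_ne' (by rwa [Ne, dotProduct_self_eq_zero])
    have hs : √(p ⬝ᵥ p) ≠ 0 := (Real.sqrt_pos.2 hpos).ne'
    have hs2 := Real.mul_self_sqrt hpos.le
    refine ⟨(√(p ⬝ᵥ p))⁻¹ • p, √(p ⬝ᵥ p), ?_, ?_, Real.sqrt_nonneg _, fun u hu => ?_⟩
    · rw [mulVec_smul, hp, smul_comm]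
    · rw [smul_dotProduct, dotProduct_smul, smul_eq_mul, smul_eq_mul]
      nth_rw 3 [← hs2]
      field_simp
    · rw [hpu u hu, smul_dotProduct, smul_eq_mul]
      field_simp

/-- If `λ_min(D) = λ_min(A)`, there is a bottom eigenvector with nonzero first entry, and it can be
normalized to `[1; x]` with `x` orthogonal to the bottom eigenspace of `A` and `‖x‖² ≤ Δ`. -/
theorem exists_orthogonal_bottomEigenvector (hA : A.IsSymm) (hΔ : 0 < Δ)
    (hopt : IsDualKOptimal A a b c Δ t l)
    (heq : lambdaMin (borderedD A a b t l) = lambdaMin A) :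
    (∃ (y₀ : ℝ) (z₀ : Fin n → ℝ), IsNormalizedBottomEigenvector A a b t l y₀ z₀ ∧ y₀ ≠ 0) ∧
    ∃ x : Fin n → ℝ, borderedD A a b t l *ᵥ Sum.elim (fun _ => 1) x =
      lambdaMin (borderedD A a b t l) • Sum.elim (fun _ => 1) x ∧
      (∀ u, A *ᵥ u = lambdaMin A • u → x ⬝ᵥ u = 0) ∧ x ⬝ᵥ x ≤ Δ := by
  -- Decreasing `t` gives `y ^ 2 ≥ 1 / (Δ + 1)`, which yields both `y ≠ 0` and the norm bound.
  obtain ⟨y, z, hyz, hle⟩ := exists_bottomEigenvector_direction hA hΔ hopt (-1) 0 (Or.inr le_rfl)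
  have hy2 : 1 ≤ (Δ + 1) * y ^ 2 := by linarith
  have hy : y ≠ 0 := by rintro rfl; norm_num at hy2
  refine ⟨⟨y, z, hyz, hy⟩, ?_⟩
  have hx := bottomEigenvector_normalize hy hyz.1
  obtain ⟨p, hp, hpu⟩ := exists_dotProduct_eq_on_submodule
    (Module.End.eigenspace (Matrix.toLin' A) (lambdaMin A)) (y⁻¹ • z)
  simp only [mem_eigenspace_toLin'_iff] at hp hpu
  have horth : ∀ u, A *ᵥ u = lambdaMin A • u → (y⁻¹ • z + -p) ⬝ᵥ u = 0 := fun u hu => by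
    rw [add_dotProduct, hpu u hu, neg_dotProduct, add_neg_cancel]
  have hx' := bottomEigenvector_add hA heq hx (u := -p) (by rw [mulVec_neg, hp, smul_neg])
  refine ⟨y⁻¹ • z + -p, hx', horth, ?_⟩
  set x := y⁻¹ • z + -p with hxdef
  have hz : z = y • x + y • p := by
    rw [hxdef, smul_add, smul_inv_smul₀ hy, smul_neg]
    abel
  have h1 := hyz.2
  rw [hz] at h1
  simp only [add_dotProduct, dotProduct_add, smul_dotProduct, dotProduct_smul, smul_eq_mul,
    dotProduct_comm p x, horth p hp] at h1
  have h2 : y ^ 2 * (1 + x ⬝ᵥ x) ≤ 1 := by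
    have := mul_nonneg (sq_nonneg y) (dotProduct_self_nonneg_real p)
    linarith
  have hy0 : 0 < y ^ 2 := by positivity
  have : y ^ 2 * (1 + x ⬝ᵥ x) ≤ y ^ 2 * (Δ + 1) := by linarith
  linarith [le_of_mul_le_mul_left this hy0]

/-- Optimality of `(t, l)` places the hyperplane `bᵀx = c` within reach of the sphere `‖x‖² = Δ`
on the face `x₀ + Null(A - λ_min(A) I)`. -/
theorem mul_sub_le_of_isDualKOptimal (hA : A.IsSymm) (hΔ : 0 < Δ)
    (hopt : IsDualKOptimal A a b c Δ t l)
    (heq : lambdaMin (borderedD A a b t l) = lambdaMin A) {x e : Fin n → ℝ} {B r : ℝ}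
    (hx : borderedD A a b t l *ᵥ Sum.elim (fun _ => 1) x =
      lambdaMin (borderedD A a b t l) • Sum.elim (fun _ => 1) x)
    (horth : ∀ u, A *ᵥ u = lambdaMin A • u → x ⬝ᵥ u = 0) (hxΔ : x ⬝ᵥ x ≤ Δ)
    (he : e ⬝ᵥ e = 1) (hB : 0 ≤ B) (hbu : ∀ u, A *ᵥ u = lambdaMin A • u → b ⬝ᵥ u = B * (e ⬝ᵥ u))
    (hr : 0 < l ∨ 0 ≤ r) (hr1 : |r| = 1) :
    r * (b ⬝ᵥ x - c) ≤ √(Δ - x ⬝ᵥ x) * B := by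
  set ρ := √(Δ - x ⬝ᵥ x) with hρ
  have hρ0 : 0 ≤ ρ := Real.sqrt_nonneg _
  have hρ2 : ρ ^ 2 = Δ - x ⬝ᵥ x := Real.sq_sqrt (by linarith)
  by_contra! hlt
  -- The slack makes `R` and `B'` positive even when `ρ` or `B` is zero.
  obtain ⟨δ, hδ, hδlt⟩ : ∃ δ : ℝ, 0 < δ ∧ (ρ + δ) * (B + δ) < r * (b ⬝ᵥ x - c) := by
    have hc : ContinuousAt (fun δ : ℝ => (ρ + δ) * (B + δ)) 0 := by fun_prop
    have hev := hc.eventually_lt (continuousAt_const (y := r * (b ⬝ᵥ x - c))) (by simpa using hlt)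
    obtain ⟨δ, h1, h2⟩ := ((hev.filter_mono nhdsWithin_le_nhds).and
      (self_mem_nhdsWithin (s := Set.Ioi (0 : ℝ)))).exists
    exact ⟨δ, h2, h1⟩
  set R := ρ + δ with hR
  set B' := B + δ with hB'
  have hR0 : 0 < R := by linarith
  have hB'0 : 0 < B' := by linarith
  -- `B' / (2 * R)` is the multiplier for minimising a linear form of slope `B'` over a ball of
  -- radius `R`. At `(1, x + u)` the inequality reads `r (bᵀ(x + u) - c) + B' / (2 R) * (‖u‖² - ρ²)
  -- ≤ 0`.
  obtain ⟨y, z, hyz, hle⟩ := exists_bottomEigenvector_direction hA hΔ hopt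
    (-(r * c) - (Δ + 1) * B' / (2 * R)) r hr
  set u := z - y • x with hu
  have huN : A *ᵥ u = lambdaMin A • u := by
    rw [← heq]; exact eigenvector_sub_of_bottomEigenvector hx hyz.1
  have hz : z = y • x + u := by rw [hu]; abel
  have hbz : b ⬝ᵥ z = y * (b ⬝ᵥ x) + B * (e ⬝ᵥ u) := by
    rw [hz, dotProduct_add, dotProduct_smul, hbu u huN, smul_eq_mul]
  have hn : y ^ 2 * (1 + x ⬝ᵥ x) + u ⬝ᵥ u = 1 := by
    have h1 := hyz.2
    rw [hz] at h1
    simp only [add_dotProduct, dotProduct_add, smul_dotProduct, dotProduct_smul, smul_eq_mul,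
      dotProduct_comm u x, horth u huN] at h1
    linarith
  have hq := dotProduct_sq_le_of_unit he u
  rw [hbz] at hle
  set q := e ⬝ᵥ u
  set U := u ⬝ᵥ u
  have hkey : 2 * R * y ^ 2 * (r * (b ⬝ᵥ x - c)) - B' * y ^ 2 * ρ ^ 2 + 2 * R * B * (r * y * q)
      + B' * U ≤ 0 := by
    have h1 : 0 < 2 * R / (Δ + 1) := by positivity
    have h2 := mul_le_mul_of_nonneg_left hle h1.le
    have hΔ1 : Δ + 1 ≠ 0 := by linarith
    have e1 : 2 * R / (Δ + 1) * ((Δ + 1) * ((-(r * c) - (Δ + 1) * B' / (2 * R)) * y ^ 2 +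
        r * (y * (y * (b ⬝ᵥ x) + B * q)))) =
        2 * R * y ^ 2 * (r * (b ⬝ᵥ x - c)) - (Δ + 1) * B' * y ^ 2 + 2 * R * B * (r * y * q) := by
      generalize b ⬝ᵥ x = β
      field_simp
      ring
    have e2 : 2 * R / (Δ + 1) * (-(r * c) - (Δ + 1) * B' / (2 * R) + r * c) = -B' := by
      field_simp
      ring
    rw [e1, e2] at h2
    have h3 : B' * (y ^ 2 * (1 + x ⬝ᵥ x) + U) = B' := by rw [hn, mul_one]
    rw [hρ2]
    linarith
  have hcross : -(|y| * |q|) ≤ r * y * q := by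
    have h := neg_abs_le (r * y * q)
    rwa [abs_mul, abs_mul, hr1, one_mul] at h
  have hyq : 0 ≤ |y| * |q| := by positivity
  have h1 : -(2 * R * B' * (|y| * |q|)) ≤ 2 * R * B * (r * y * q) := by
    have h2 := mul_le_mul_of_nonneg_left hcross (by positivity : 0 ≤ 2 * R * B)
    have h3 : 2 * R * B * (|y| * |q|) ≤ 2 * R * B' * (|y| * |q|) := by gcongr; linarith
    linarith
  have h2 : B' * y ^ 2 * ρ ^ 2 ≤ B' * y ^ 2 * R ^ 2 := by gcongr; linarith
  have h3 : B' * q ^ 2 ≤ B' * U := by gcongr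
  have h4 : 0 ≤ B' * (R * |y| - |q|) ^ 2 := by positivity
  have h5 : B' * (R * |y| - |q|) ^ 2 = B' * R ^ 2 * y ^ 2 - 2 * R * B' * (|y| * |q|) + B' * q ^ 2 := by
    rw [← sq_abs y, ← sq_abs q]; ring
  have h6 : 2 * R * y ^ 2 * (r * (b ⬝ᵥ x - c) - R * B') ≤ 0 := by
    linarith
  have hy : y = 0 := by
    by_contra hy
    have : 0 < 2 * R * y ^ 2 * (r * (b ⬝ᵥ x - c) - R * B') :=
      mul_pos (by positivity) (by linarith)
    linarith
  rw [hy] at hkey hn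
  have hU : U = 1 := by linarith
  rw [hU] at hkey
  linarith

theorem exists_unit_eigenvector_orthogonal {e : Fin n → ℝ} {s : ℝ} (he : A *ᵥ e = s • e)
    (he1 : e ⬝ᵥ e = 1)
    (hdim : Module.finrank ℝ (Module.End.eigenspace (Matrix.toLin' A) s) ≠ 1) :
    ∃ f : Fin n → ℝ, A *ᵥ f = s • f ∧ f ⬝ᵥ f = 1 ∧ e ⬝ᵥ f = 0 := by
  have hne : (⟨e, (mem_eigenspace_toLin'_iff s e).2 he⟩ :
      Module.End.eigenspace (Matrix.toLin' A) s) ≠ 0 := by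
    intro h
    have h0 : e = 0 := congrArg Subtype.val h
    simp [h0] at he1
  have hspan := mt (finrank_eq_one_iff_of_nonzero' _ hne).2 hdim
  push Not at hspan
  obtain ⟨⟨w, hw⟩, hwe⟩ := hspan
  rw [mem_eigenspace_toLin'_iff] at hw
  set v := w - (e ⬝ᵥ w) • e with hv
  have hvN : A *ᵥ v = s • v := by
    rw [hv, mulVec_sub, mulVec_smul, hw, he, smul_sub, smul_comm]
  have hv0 : v ≠ 0 := by
    intro h
    exact hwe (e ⬝ᵥ w) (Subtype.ext (sub_eq_zero.1 h).symm)
  have hev : e ⬝ᵥ v = 0 := by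
    rw [hv, dotProduct_sub, dotProduct_smul, he1, smul_eq_mul, mul_one, sub_self]
  have hpos : 0 < v ⬝ᵥ v :=
    (dotProduct_self_nonneg_real v).lt_of_ne' (by rwa [Ne, dotProduct_self_eq_zero])
  have hs : √(v ⬝ᵥ v) ≠ 0 := (Real.sqrt_pos.2 hpos).ne'
  have hs2 := Real.mul_self_sqrt hpos.le
  refine ⟨(√(v ⬝ᵥ v))⁻¹ • v, ?_, ?_, ?_⟩
  · rw [mulVec_smul, hvN, smul_comm]
  · rw [smul_dotProduct, dotProduct_smul, smul_eq_mul, smul_eq_mul]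
    nth_rw 3 [← hs2]
    field_simp
  · rw [dotProduct_smul, hev, smul_zero]

/-- Outside the gap condition, the bottom face contains a feasible complementary point. -/
theorem exists_complementary_feasible (hA : A.IsSymm) (hA' : ¬ A.PosDef) (hΔ : 0 < Δ)
    (hopt : IsDualKOptimal A a b c Δ t l)
    (heq : lambdaMin (borderedD A a b t l) = lambdaMin A) (hgap : ¬ GapCondition A a b c Δ l) :
    ∃ x : Fin n → ℝ, borderedD A a b t l *ᵥ Sum.elim (fun _ => 1) x =
      lambdaMin (borderedD A a b t l) • Sum.elim (fun _ => 1) x ∧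
      x ∈ etrsFeasible b c Δ ∧ lambdaMin (borderedD A a b t l) * (x ⬝ᵥ x - Δ) = 0 ∧
      l * (b ⬝ᵥ x - c) = 0 := by
  have := nonempty_of_not_posDef hA'
  obtain ⟨-, x, hx, horth, hxΔ⟩ := exists_orthogonal_bottomEigenvector hA hΔ hopt heq
  obtain ⟨e, B, he, he1, hB, hbu⟩ := exists_unit_direction_on_eigenspace hA b
  have hlow := mul_sub_le_of_isDualKOptimal (r := 1) hA hΔ hopt heq hx horth hxΔ he1 hB hbu
    (Or.inr zero_le_one) abs_one
  have hup : 0 < l → _ := fun hl => mul_sub_le_of_isDualKOptimal (r := -1) hA hΔ hopt heq hx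
    horth hxΔ he1 hB hbu (Or.inl hl) (by simp)
  have hρ2 : √(Δ - x ⬝ᵥ x) ^ 2 = Δ - x ⬝ᵥ x := Real.sq_sqrt (by linarith)
  have hρ0 := Real.sqrt_nonneg (Δ - x ⬝ᵥ x)
  set ρ := √(Δ - x ⬝ᵥ x)
  have hnorm : ∀ u, A *ᵥ u = lambdaMin A • u → (x + u) ⬝ᵥ (x + u) = Δ - ρ ^ 2 + u ⬝ᵥ u := by
    intro u hu
    rw [hρ2]
    simp only [add_dotProduct, dotProduct_add, dotProduct_comm u x, horth u hu]
    ring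
  have hb : ∀ u, A *ᵥ u = lambdaMin A • u → b ⬝ᵥ (x + u) = b ⬝ᵥ x + B * (e ⬝ᵥ u) := by
    intro u hu
    rw [dotProduct_add, hbu u hu]
  have heθ : ∀ θ : ℝ, A *ᵥ (θ • e) = lambdaMin A • (θ • e) := fun θ => by
    rw [mulVec_smul, he, smul_comm]
  have heθ1 : ∀ θ : ℝ, e ⬝ᵥ (θ • e) = θ := fun θ => by simp [he1]
  have heθ2 : ∀ θ : ℝ, (θ • e) ⬝ᵥ (θ • e) = θ ^ 2 := fun θ => by simp [he1, pow_two]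
  rcases hopt.1.eq_or_lt with hl | hl
  -- With `l = 0` only the norm must be complementary, so `bᵀx` is lowered as far as the sphere
  -- permits.
  · have hu := heθ (-ρ)
    refine ⟨x + (-ρ) • e, bottomEigenvector_add hA heq hx hu, ⟨?_, ?_⟩, ?_, ?_⟩
    · rw [hnorm _ hu, heθ2]; linarith [neg_sq ρ]
    · rw [hb _ hu, heθ1]; linarith
    · rw [hnorm _ hu, heθ2]; ring
    · rw [← hl, zero_mul]
  have hup := hup hl
  obtain ⟨θ, hθ, hθρ⟩ : ∃ θ : ℝ, b ⬝ᵥ x + B * θ = c ∧ θ ^ 2 ≤ ρ ^ 2 := by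
    rcases hB.eq_or_lt with hB0 | hB0
    · rw [← hB0, mul_zero] at hlow hup
      exact ⟨0, by rw [mul_zero]; linarith, by rw [zero_pow two_ne_zero]; positivity⟩
    · refine ⟨(c - b ⬝ᵥ x) / B, by field_simp; ring, ?_⟩
      refine sq_le_sq' ?_ ?_
      · rw [le_div_iff₀ hB0]; linarith
      · rw [div_le_iff₀ hB0]; linarith
  by_cases hμ : lambdaMin A = 0
  · have hu := heθ θ
    refine ⟨x + θ • e, bottomEigenvector_add hA heq hx hu, ⟨?_, ?_⟩, ?_, ?_⟩
    · rw [hnorm _ hu, heθ2]; linarith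
    · rw [hb _ hu, heθ1, hθ]
    · rw [heq, hμ, zero_mul]
    · rw [hb _ hu, heθ1, hθ, sub_self, mul_zero]
  have hμ' : lambdaMin A < 0 := (lambdaMin_nonpos_of_not_posDef hA hA').lt_of_ne hμ
  suffices h : ∃ u, A *ᵥ u = lambdaMin A • u ∧ u ⬝ᵥ u = ρ ^ 2 ∧ b ⬝ᵥ (x + u) = c by
    obtain ⟨u, hu, hu1, hu2⟩ := h
    refine ⟨x + u, bottomEigenvector_add hA heq hx hu, ⟨?_, hu2.le⟩, ?_, ?_⟩
    · rw [hnorm _ hu, hu1]; linarith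
    · rw [hnorm _ hu, hu1]; ring
    · rw [hu2, sub_self, mul_zero]
  by_cases hdim : Module.finrank ℝ (Module.End.eigenspace (Matrix.toLin' A) (lambdaMin A)) = 1
  · have hsol : ∀ u, A *ᵥ u = lambdaMin A • u →
        (A - lambdaMin A • (1 : Matrix (Fin n) (Fin n) ℝ)) *ᵥ (x + u) = a - (l / 2) • b := by
      intro u hu
      have h1 := ((borderedD_mulVec_eq_smul_iff _ _ _).1 (bottomEigenvector_add hA heq hx hu)).2
      rw [heq, one_smul] at h1
      rw [sub_mulVec, smul_mulVec, one_mulVec, ← h1]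
      abel
    have hprod : 0 ≤ (b ⬝ᵥ (x + ρ • e) - c) * (b ⬝ᵥ (x + (-ρ) • e) - c) := by
      by_contra! hneg
      refine hgap ⟨hμ', hdim, hl, x + ρ • e, x + (-ρ) • e, hsol _ (heθ _), hsol _ (heθ _),
        ?_, ?_, hneg⟩
      · rw [hnorm _ (heθ _), heθ2]; ring
      · rw [hnorm _ (heθ _), heθ2]; ring
    -- The product equals `(bᵀx - c)² - (B ρ)²`, nonpositive by `hlow` and `hup`.
    have hzero : (b ⬝ᵥ (x + ρ • e) - c) * (b ⬝ᵥ (x + (-ρ) • e) - c) = 0 := by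
      refine le_antisymm ?_ hprod
      rw [hb _ (heθ _), hb _ (heθ _), heθ1, heθ1]
      nlinarith
    rcases mul_eq_zero.1 hzero with h | h
    · exact ⟨ρ • e, heθ _, heθ2 _, sub_eq_zero.1 h⟩
    · exact ⟨(-ρ) • e, heθ _, by rw [heθ2, neg_sq], sub_eq_zero.1 h⟩
  -- Moving along `f` leaves `bᵀx` unchanged, so it absorbs the missing norm.
  · obtain ⟨f, hf, hf1, hef⟩ := exists_unit_eigenvector_orthogonal he he1 hdim
    have hu : A *ᵥ (θ • e + √(ρ ^ 2 - θ ^ 2) • f) =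
        lambdaMin A • (θ • e + √(ρ ^ 2 - θ ^ 2) • f) := by
      rw [mulVec_add, heθ, mulVec_smul, hf, smul_add, smul_comm _ (lambdaMin A) f]
    refine ⟨θ • e + √(ρ ^ 2 - θ ^ 2) • f, hu, ?_, ?_⟩
    · simp only [add_dotProduct, dotProduct_add, smul_dotProduct, dotProduct_smul, smul_eq_mul,
        he1, hf1, hef, dotProduct_comm f e]
      have := Real.mul_self_sqrt (sub_nonneg.2 hθρ)
      linarith
    · rw [hb _ hu, dotProduct_add, heθ1, dotProduct_smul, hef, smul_zero, add_zero, hθ]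

/-! ### Failure of strong duality under the gap condition. -/

theorem exists_isEtrsOptimal (hne : (etrsFeasible b c Δ).Nonempty) :
    ∃ x, IsEtrsOptimal A a b c Δ x := by
  have hcl : IsClosed (etrsFeasible b c Δ) := by
    refine (isClosed_le (f := fun x : Fin n → ℝ => x ⬝ᵥ x) ?_ continuous_const).inter
      (isClosed_le (f := fun x : Fin n → ℝ => b ⬝ᵥ x) ?_ continuous_const)
    · simp only [dotProduct]; fun_prop
    · simp only [dotProduct]; fun_prop
  have hbd : Bornology.IsBounded (etrsFeasible b c Δ) := by
    refine (Metric.isBounded_closedBall (x := (0 : Fin n → ℝ)) (r := √Δ)).subset fun v hv => ?_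
    rw [mem_closedBall_zero_iff, pi_norm_le_iff_of_nonneg (Real.sqrt_nonneg _)]
    intro i
    have h : v i * v i ≤ v ⬝ᵥ v := Finset.single_le_sum (f := fun j => v j * v j)
      (fun j _ => mul_self_nonneg _) (Finset.mem_univ i)
    rw [Real.norm_eq_abs]
    exact Real.abs_le_sqrt (by linarith [pow_two (v i), hv.1])
  have hcont : Continuous (etrsObj A a) := by
    unfold etrsObj
    simp only [dotProduct, mulVec]
    fun_prop
  obtain ⟨x, hx, hmin⟩ := (Metric.isCompact_of_isClosed_isBounded hcl hbd).exists_isMinOn hne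
    hcont.continuousOn
  exact ⟨x, hx, fun w hw => hmin hw⟩

theorem etrsValue_eq_of_isEtrsOptimal {x : Fin n → ℝ} (hx : IsEtrsOptimal A a b c Δ x) :
    etrsValue A a b c Δ = ((etrsObj A a x : ℝ) : EReal) :=
  le_antisymm (iInf₂_le x hx.1) (le_iInf₂ fun w hw => by exact_mod_cast hx.2 w hw)

/-- Under strong duality, a primal optimal solution satisfies stationarity and complementarity. -/
theorem complementary_of_strongDuality (hA : A.IsSymm) (hA' : ¬ A.PosDef) (hΔ : 0 < Δ)
    (hopt : IsDualKOptimal A a b c Δ t l) (hsd : EtrsStrongDuality A a b c Δ)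
    {x : Fin n → ℝ} (hx : IsEtrsOptimal A a b c Δ x) :
    borderedD A a b t l *ᵥ Sum.elim (fun _ => 1) x =
      lambdaMin (borderedD A a b t l) • Sum.elim (fun _ => 1) x ∧
      lambdaMin (borderedD A a b t l) * (x ⬝ᵥ x - Δ) = 0 ∧ l * (b ⬝ᵥ x - c) = 0 := by
  have := nonempty_of_not_posDef hA'
  have hs : 0 ≤ -lambdaMin (borderedD A a b t l) := by
    linarith [lambdaMin_borderedD_le (a := a) (b := b) (t := t) (l := l) hA,
      lambdaMin_nonpos_of_not_posDef hA hA']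
  have hval : etrsObj A a x = dualK A a b c Δ t l := by
    rw [EtrsStrongDuality, etrsValue_eq_of_isEtrsOptimal hx,
      etrsDualValue_eq_dualK hA hA' hΔ hopt] at hsd
    exact_mod_cast hsd
  have hL := dualK_le_etrsLagrangian (a := a) (b := b) (c := c) (Δ := Δ) (t := t) (l := l) hA x
  have hL' := etrsLagrangian_eq (A := A) (a := a) (b := b) (t := t) (l := l) (c := c) (Δ := Δ)
      (lambdaMin (borderedD A a b t l)) x
  have h1 := mul_nonneg hs (sub_nonneg.2 hx.1.1)
  have h2 := mul_nonneg hopt.1 (sub_nonneg.2 hx.1.2)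
  have hdef : etrsLagrangian A a b c Δ (-lambdaMin (borderedD A a b t l)) l x = etrsObj A a x +
    -lambdaMin (borderedD A a b t l) * (x ⬝ᵥ x - Δ) + l * (b ⬝ᵥ x - c) := rfl
  -- The Lagrangian is at least the optimal value and equals it plus two nonpositive terms, so both
  -- vanish.
  refine ⟨?_, by linarith, by linarith⟩
  refine mulVec_eq_lambdaMin_smul_of_le (borderedD_isSymm hA) ?_
  rw [borderedD_quadratic, sumElim_dotProduct_self]
  have hk : dualK A a b c Δ t l = (Δ + 1) * lambdaMin (borderedD A a b t l) - t - l * c := rfl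
  linarith

/-- Strong duality would put an optimal `x` on both sphere and hyperplane, collinear with `x₁` and
`x₂`. A line meets a sphere at most twice, so `x₂` is `x` or `x₁`, and the product cannot be
negative. -/
theorem not_strongDuality_of_gapCondition (hA : A.IsSymm) (hA' : ¬ A.PosDef) (hΔ : 0 < Δ)
    (hne : (etrsFeasible b c Δ).Nonempty) (hopt : IsDualKOptimal A a b c Δ t l)
    (heq : lambdaMin (borderedD A a b t l) = lambdaMin A) (hgap : GapCondition A a b c Δ l) :
    ¬ EtrsStrongDuality A a b c Δ := by
  intro hsd
  obtain ⟨x, hx⟩ := exists_isEtrsOptimal (A := A) (a := a) hne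
  obtain ⟨hD, hc₁, hc₂⟩ := complementary_of_strongDuality hA hA' hΔ hopt hsd hx
  obtain ⟨hμ, hdim, hl, x₁, x₂, h₁, h₂, hn₁, hn₂, hprod⟩ := hgap
  rw [heq] at hD hc₁
  have hn : x ⬝ᵥ x = Δ := sub_eq_zero.1 ((mul_eq_zero.1 hc₁).resolve_left hμ.ne)
  have hb : b ⬝ᵥ x = c := sub_eq_zero.1 ((mul_eq_zero.1 hc₂).resolve_left hl.ne')
  have hDx := ((borderedD_mulVec_eq_smul_iff _ _ _).1 hD).2
  rw [one_smul, sub_eq_iff_eq_add] at hDx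
  simp only [sub_mulVec, smul_mulVec, one_mulVec] at h₁ h₂
  rw [sub_eq_iff_eq_add] at h₁ h₂
  have hd₁ : A *ᵥ (x₁ - x) = lambdaMin A • (x₁ - x) := by
    rw [mulVec_sub, h₁, hDx]; module
  have hd₂ : A *ᵥ (x₂ - x) = lambdaMin A • (x₂ - x) := by
    rw [mulVec_sub, h₂, hDx]; module
  have hne₁ : (⟨x₁ - x, (mem_eigenspace_toLin'_iff _ _).2 hd₁⟩ :
      Module.End.eigenspace (Matrix.toLin' A) (lambdaMin A)) ≠ 0 := by
    intro h
    have h0 : x₁ - x = 0 := congrArg Subtype.val h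
    rw [sub_eq_zero.1 h0, hb] at hprod
    simp at hprod
  obtain ⟨k, hk⟩ := (finrank_eq_one_iff_of_nonzero' _ hne₁).1 hdim
    ⟨x₂ - x, (mem_eigenspace_toLin'_iff _ _).2 hd₂⟩
  have hk' : k • (x₁ - x) = x₂ - x := congrArg Subtype.val hk
  have hd0 : x₁ - x ≠ 0 := fun h => hne₁ (Subtype.ext h)
  have e₁ : x₁ = x + (x₁ - x) := by abel
  have e₂ : x₂ = x + k • (x₁ - x) := by rw [hk']; abel
  generalize x₁ - x = d at *
  have hdpos : 0 < d ⬝ᵥ d :=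
    (dotProduct_self_nonneg_real d).lt_of_ne' (by rwa [Ne, dotProduct_self_eq_zero])
  subst e₁ e₂
  simp only [dotProduct_add, add_dotProduct, dotProduct_smul, smul_dotProduct, smul_eq_mul,
    dotProduct_comm d x, hn, hb] at hn₁ hn₂ hprod
  have hxd : 2 * (x ⬝ᵥ d) = -(d ⬝ᵥ d) := by linarith
  have hkk : k * (k - 1) * (d ⬝ᵥ d) = 0 := by linear_combination hn₂ - k * hxd
  have hk01 : k * (k - 1) = 0 := (mul_eq_zero.1 hkk).resolve_right hdpos.ne'
  have hk0 : 0 ≤ k := by nlinarith [sq_nonneg k]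
  nlinarith [mul_nonneg hk0 (sq_nonneg (b ⬝ᵥ d))]

end Bordered

theorem theorem4 {n : ℕ} (A : Matrix (Fin n) (Fin n) ℝ) (hA : A.IsSymm) (hA' : ¬ A.PosDef)
    (a b : Fin n → ℝ) (c Δ : ℝ) (hΔ : 0 < Δ)
    (slater : ∃ x : Fin n → ℝ, x ⬝ᵥ x < Δ ∧ b ⬝ᵥ x < c)
    (t l : ℝ) (hopt : IsDualKOptimal A a b c Δ t l) :
    (lambdaMin (borderedD A a b t l) < lambdaMin A →
      EtrsStrongDuality A a b c Δ ∧
      ∀ (y₀ : ℝ) (z : Fin n → ℝ), IsNormalizedBottomEigenvector A a b t l y₀ z →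
        y₀ ≠ 0 ∧ IsEtrsOptimal A a b c Δ (y₀⁻¹ • z)) ∧
    (lambdaMin (borderedD A a b t l) = lambdaMin A →
      (∃ (y₀ : ℝ) (z₀ : Fin n → ℝ), IsNormalizedBottomEigenvector A a b t l y₀ z₀ ∧ y₀ ≠ 0) ∧
      (GapCondition A a b c Δ l → ¬ EtrsStrongDuality A a b c Δ) ∧
      (¬ GapCondition A a b c Δ l →
        EtrsStrongDuality A a b c Δ ∧
        ∀ (y₀ : ℝ) (z₀ : Fin n → ℝ), IsNormalizedBottomEigenvector A a b t l y₀ z₀ → y₀ ≠ 0 →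
          ∃ z : Fin n → ℝ, A *ᵥ z = lambdaMin A • z ∧
            IsEtrsOptimal A a b c Δ (y₀⁻¹ • z₀ + z))) := by
  obtain ⟨w, hw₁, hw₂⟩ := slater
  refine ⟨fun hlt => ?_, fun heq => ⟨?_, ?_, fun hgap => ?_⟩⟩
  -- The zero direction merely supplies some unit bottom eigenvector.
  · obtain ⟨y, z, hyz, -⟩ := exists_bottomEigenvector_direction hA hΔ hopt 0 0 (Or.inr le_rfl)
    refine ⟨(strongDuality_of_lambdaMin_lt hA hA' hΔ hopt hlt hyz).2.1, fun y₀ z₀ hv => ?_⟩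
    have h := strongDuality_of_lambdaMin_lt hA hA' hΔ hopt hlt hv
    exact ⟨h.1, h.2.2⟩
  · exact (exists_orthogonal_bottomEigenvector hA hΔ hopt heq).1
  · exact not_strongDuality_of_gapCondition hA hA' hΔ ⟨w, hw₁.le, hw₂.le⟩ hopt heq
  · obtain ⟨x, hx, hf, hc₁, hc₂⟩ := exists_complementary_feasible hA hA' hΔ hopt heq hgap
    obtain ⟨hsd, hxopt⟩ := strongDuality_and_isEtrsOptimal hA hA' hΔ hopt hx hf hc₁ hc₂
    -- Every eigenvector is corrected to the same optimal `x`.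
    refine ⟨hsd, fun y₀ z₀ hv hy => ⟨x - y₀⁻¹ • z₀, ?_, ?_⟩⟩
    · have h := eigenvector_sub_of_bottomEigenvector (bottomEigenvector_normalize hy hv.1) hx
      rwa [one_smul, heq] at h
    · rwa [add_sub_cancel]
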